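/- Throughout, groups are finite. Let $p$ be a prime, let $G$ be a $p$-solvable group (that is, $G$ has a series of normal subgroups from $1$ to $G$ each of whose factors is a $p$-group or a $p'$-group), and let $P$ be a Sylow $p$-subgroup of $G$. For a finite group $H$ and $y\in H$, let $\lambda_H(y)$ be the number of Sylow $p$-subgroups of $H$ containing $y$, and let $\mathrm{Irr}(H)$ be the set of irreducible complex characters of $H$. An identification of the character table of $G$ with that of $H$ is a pair consisting of a bijection $\chi\mapsto\chi^*$ from $\mathrm{Irr}(G)$ to $\mathrm{Irr}(H)$ and a bijection $K\mapsto K^*$ from the conjugacy classes of $G$ to those of $H$ such that $\chi^*(K^*)=\chi(K)$ for all $\chi$ and $K$; $G$ and $H$ have the same character table if there is one. We say that the character table of $G$ determines $|\mathbf{N}_G(P)|$ if $|\mathbf{N}_H(Q)|=|\mathbf{N}_G(P)|$ for every finite group $H$ with the same character table as $G$ and every Sylow $p$-subgroup $Q$ of $H$. For $x\in G$, we say that it determines $\lambda_G(x)$ if $\lambda_H(y)=\lambda_G(x)$ for every finite group $H$, every identification of the character table of $G$ with that of $H$, and every $y$ in the class of $H$ corresponding to the class of $x$. It determines the function $\lambda_G$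 if it determines $\lambda_G(x)$ for every $x\in G$. Consider the following statements. 1. The character table of $G$ determines $|\mathbf{N}_G(P)|$. 2. The character table of $G$ determines the function $\lambda_G$. 3. The character table of $G$ determines $\lambda_G(x)$ for some nonidentity $p$-element $x\in G$. Then (1) and (2) are equivalent, and if $p$ divides $|G|$, then (1), (2) and (3) are equivalent. -/

import Mathlib

/-- `G` is `p`-solvable: it has a finite series of normal subgroups, from the trivial subgroup
to `G`, every factor of which has order a power of `p` or order prime to `p`. -/
def IsPSolvable (p : ℕ) (G : Type*) [Group G] : Prop :=
  ∃ (n : ℕ) (N : ℕ → Subgroup G),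
    N 0 = ⊥ ∧ N n = ⊤ ∧ (∀ i, (N i).Normal) ∧
    ∀ i < n, N i ≤ N (i + 1) ∧
      ((∃ k : ℕ, (N i).relIndex (N (i + 1)) = p ^ k) ∨
        ((N i).relIndex (N (i + 1))).Coprime p)

/-- `x` is a `p`-element: its order is a power of `p`. -/
def IsPElement (p : ℕ) {G : Type*} [Group G] (x : G) : Prop :=
  ∃ k : ℕ, orderOf x = p ^ k

/-- `λ_G(x)`: the number of Sylow `p`-subgroups of `G` that contain `x`. -/
noncomputable def sylowCount (p : ℕ) {G : Type*} [Group G] (x : G) : ℕ :=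
  Nat.card {Q : Sylow p G // x ∈ Q}

/-- The set `Irr(G)` of irreducible complex characters of `G`. -/
def Irr (G : Type*) [Group G] : Set (G → ℂ) :=
  {χ | ∃ (n : ℕ) (ρ : Representation ℂ G (Fin n → ℂ)), ρ.IsIrreducible ∧ ρ.character = χ}

theorem Irr.apply_eq_of_isConj {G : Type*} [Group G] (χ : Irr G) (a b : G) (h : IsConj a b) :
    χ.1 a = χ.1 b := by
  obtain ⟨χ, n, ρ, -, rfl⟩ := χ
  obtain ⟨c, rfl⟩ := isConj_iff.1 h
  exact (ρ.char_conj a c).symm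

/-- The character table of `G`: rows are indexed by the irreducible complex characters, columns
by the conjugacy classes. -/
def characterTable (G : Type*) [Group G] (χ : Irr G) (c : ConjClasses G) : ℂ :=
  Quotient.lift χ.1 (Irr.apply_eq_of_isConj χ) c

/-- An identification of the character tables of `G` and `H`: a bijection between the rows and
a bijection between the columns that match all the entries. `G` and `H` have the same character
table if there is one. -/
structure CharacterTableIso (G H : Type*) [Group G] [Group H] where
  rows : Irr G ≃ Irr H
  cols : ConjClasses G ≃ ConjClasses H
  entry : ∀ (χ : Irr G) (c : ConjClasses G),
    characterTable H (rows χ) (cols c) = characterTable G χ c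

universe u

/-- The character table of `G` determines `|N_G(P)|`, for a Sylow `p`-subgroup `P` of `G`: in
every finite group with the same character table, the normalizers of the Sylow `p`-subgroups
have the same order. -/
def TableDeterminesNormalizer (p : ℕ) {G : Type u} [Group G] (P : Sylow p G) : Prop :=
  ∀ (H : Type u) [Group H] [Finite H], Nonempty (CharacterTableIso G H) →
    ∀ Q : Sylow p H,
      Nat.card (Subgroup.normalizer (Q : Set H)) = Nat.card (Subgroup.normalizer (P : Set G))

/-- The character table of `G` determines the value `λ_G(x)`: whenever the table of `G` is
identified with the table of a finite group `H`, the number `λ_H(y)` is `λ_G(x)` for every `y` in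
the class of `H` that corresponds to the class of `x`. -/
def TableDeterminesSylowCountAt (p : ℕ) {G : Type u} [Group G] (x : G) : Prop :=
  ∀ (H : Type u) [Group H] [Finite H] (T : CharacterTableIso G H) (y : H),
    T.cols (ConjClasses.mk x) = ConjClasses.mk y → sylowCount p y = sylowCount p x

/-- The character table of `G` determines the function `λ_G`. -/
def TableDeterminesSylowCount (p : ℕ) (G : Type u) [Group G] : Prop :=
  ∀ x : G, TableDeterminesSylowCountAt p x

/-! Count the `g` with `g⁻¹ * x * g ∈ P`. The map `g ↦ g • P` onto the Sylow subgroups containing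
`x` has fibres of size `|N_G(P)|`, so this count is `λ_G(x) * |N_G(P)|`
(`sylowCount_mul_card_normalizer`). If the table fixes the count at `p`-elements, it fixes either
factor once it fixes the other: `λ_G` is positive at `p`-elements and zero elsewhere, so a single
value at one `p`-element already gives `|N_G(P)|`.

That the table fixes the count (`TableCorr.conjIntoCount_eq`) is proved by induction along the
`p`-series. A bottom factor `N` that is a `p`-group lies in `P`, and the count is `|N|` times that
of `G ⧸ N`. If `N` is a `p'`-group, the count divided by the centralizer order is `|x^G ∩ P|`, which
does not change in `G ⧸ N`. The induction needs the table to yield centralizer orders (column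
orthogonality), normal subgroups with their orders and quotient tables (kernels of characters), and
the set of `p`-elements (congruences modulo a maximal ideal over `p`, `isPElement_iff_reduction`).
-/

/-! ### Traces of endomorphisms of finite order on their image. -/

open Module in
/-- The traces of the powers of an endomorphism `f` with `f ^ (m + 1) = f` are the power sums of
its eigenvalues, counted with multiplicity. -/
theorem trace_pow_eq_sum_eigenvalues {V : Type*} [AddCommGroup V] [Module ℂ V]
    [FiniteDimensional ℂ V] (f : End ℂ V) {m : ℕ} (hm : 0 < m) (hf : f ^ (m + 1) = f) :
    ∃ s : Finset ℂ, (∀ μ ∈ s, f.HasEigenvalue μ ∧ μ ^ (m + 1) = μ) ∧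
      ∀ k : ℕ, LinearMap.trace ℂ V (f ^ k) =
        ∑ μ ∈ s, (finrank ℂ (f.eigenspace μ) : ℂ) * μ ^ k := by
  classical
  have hss : f.IsSemisimple := by
    -- `X ^ (m + 1) - X` is separable over `ℂ`, so `f` is diagonalizable.
    refine Module.End.isSemisimple_of_squarefree_aeval_eq_zero
      (p := Polynomial.X ^ (m + 1) - Polynomial.X) ?_ (by simp [hf])
    have h1 : (Polynomial.X ^ m - 1 : Polynomial ℂ).Separable := by
      rw [Polynomial.X_pow_sub_one_separable_iff]
      exact_mod_cast hm.ne'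
    have h2 : (Polynomial.X : Polynomial ℂ) ^ (m + 1) - Polynomial.X
        = Polynomial.X * (Polynomial.X ^ m - 1) := by ring
    rw [h2]
    refine (Polynomial.Separable.mul Polynomial.separable_X h1 ?_).squarefree
    refine ⟨Polynomial.X ^ (m - 1), -1, ?_⟩
    rw [← pow_succ, Nat.sub_add_cancel hm]
    ring
  have hint : DirectSum.IsInternal f.eigenspace := by
    refine (DirectSum.isInternal_submodule_iff_iSupIndep_and_iSup_eq_top _).2
      ⟨f.eigenspaces_iSupIndep, ?_⟩
    rw [← Module.End.iSup_maxGenEigenspace_eq_top f]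
    exact iSup_congr fun μ => (hss.isFinitelySemisimple.maxGenEigenspace_eq_eigenspace μ).symm
  have hfin : {μ | f.eigenspace μ ≠ ⊥}.Finite :=
    WellFoundedGT.finite_ne_bot_of_iSupIndep f.eigenspaces_iSupIndep
  refine ⟨hfin.toFinset, ?_, ?_⟩
  · intro μ hμ
    have hev : f.HasEigenvalue μ := by
      simpa [Module.End.hasEigenvalue_iff] using hμ
    refine ⟨hev, ?_⟩
    obtain ⟨v, hv⟩ := hev.exists_hasEigenvector
    have h1 := hv.pow_apply (m + 1)
    rw [hf, hv.apply_eq_smul] at h1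
    exact (smul_left_injective ℂ hv.2 h1).symm
  · intro k
    have hmaps : ∀ μ, Set.MapsTo (f ^ k) (f.eigenspace μ) (f.eigenspace μ) := fun μ =>
      Module.End.mapsTo_genEigenspace_of_comm ((Commute.refl f).pow_right k) μ 1
    rw [LinearMap.trace_eq_sum_trace_restrict' hint hfin hmaps]
    refine Finset.sum_congr rfl fun μ _ => ?_
    have : (f ^ k).restrict (hmaps μ) = μ ^ k • LinearMap.id := by
      ext ⟨v, hv⟩
      have hv' : f v = μ • v := Module.End.mem_eigenspace_iff.1 hv
      have : ∀ j : ℕ, (f ^ j) v = μ ^ j • v := by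
        intro j
        induction j with
        | zero => simp
        | succ j ih => rw [pow_succ', Module.End.mul_apply, ih, map_smul, hv', smul_smul, pow_succ]
      exact this k
    rw [this, map_smul, LinearMap.trace_id, smul_eq_mul, mul_comm]

-- The eigenvalues are zero or roots of unity. Zero is allowed so that the lemma covers a group
-- element composed with a commuting projection, as in `integral_average_character`.
open Module in
theorem trace_isIntegral_of_pow_succ_eq {V : Type*} [AddCommGroup V] [Module ℂ V]
    [FiniteDimensional ℂ V] (f : End ℂ V) {m : ℕ} (hm : 0 < m) (hf : f ^ (m + 1) = f) :
    IsIntegral ℤ (LinearMap.trace ℂ V f) := by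
  obtain ⟨s, hs, h⟩ := trace_pow_eq_sum_eigenvalues f hm hf
  have h1 := h 1
  simp only [pow_one] at h1
  rw [h1]
  refine IsIntegral.sum _ fun μ hμ => IsIntegral.mul (isIntegral_natCast _) ?_
  refine ⟨Polynomial.X ^ (m + 1) - Polynomial.X, ?_, by simp [(hs μ hμ).2]⟩
  exact Polynomial.monic_X_pow_sub (by rw [Polynomial.degree_X]; exact_mod_cast Nat.succ_lt_succ hm)

/-! ### Character values as sums of roots of unity. -/

section character
variable {G : Type*} [Group G] [Finite G] {V : Type*} [AddCommGroup V] [Module ℂ V]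
  [FiniteDimensional ℂ V] (ρ : Representation ℂ G V)

open Module

theorem Representation.character_pow_eq_sum_eigenvalues (g : G) :
    ∃ s : Finset ℂ, (∀ μ ∈ s, Module.End.HasEigenvalue (ρ g) μ ∧ μ ^ orderOf g = 1) ∧
      ∀ k : ℕ, ρ.character (g ^ k) =
        ∑ μ ∈ s, (finrank ℂ (Module.End.eigenspace (ρ g) μ) : ℂ) * μ ^ k := by
  obtain ⟨s, hs, h⟩ := trace_pow_eq_sum_eigenvalues (ρ g) (orderOf_pos g)
    (by rw [← map_pow, pow_succ, pow_orderOf_eq_one, one_mul])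
  refine ⟨s, fun μ hμ => ⟨(hs μ hμ).1, ?_⟩, fun k => by rw [← h k, ← map_pow]; rfl⟩
  have h1 := (hs μ hμ).2
  have h0 : μ ≠ 0 := by
    rintro rfl
    obtain ⟨v, hv⟩ := (hs 0 hμ).1.exists_hasEigenvector
    have h2 : (ρ g⁻¹) (ρ g v) = v := by
      rw [← Module.End.mul_apply, ← map_mul]; simp
    rw [hv.apply_eq_smul] at h2
    exact hv.2 (by simpa using h2.symm)
  rw [pow_succ] at h1
  exact mul_right_cancel₀ h0 (by rw [h1, one_mul])

theorem norm_eq_one_of_pow_orderOf {g : G} {μ : ℂ} (h : μ ^ orderOf g = 1) : ‖μ‖ = 1 :=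
  Complex.norm_eq_one_of_pow_eq_one h (orderOf_pos g).ne'

theorem Representation.character_inv_eq_conj (g : G) :
    ρ.character g⁻¹ = starRingEnd ℂ (ρ.character g) := by
  obtain ⟨s, hs, h⟩ := ρ.character_pow_eq_sum_eigenvalues g
  have h1 := h 1
  have h2 := h (orderOf g - 1)
  have h3 : g ^ (orderOf g - 1) = g⁻¹ := by
    rw [eq_inv_iff_mul_eq_one, ← pow_succ, Nat.sub_add_cancel (orderOf_pos g), pow_orderOf_eq_one]
  simp only [pow_one] at h1
  rw [h3] at h2
  rw [h1, h2, map_sum]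
  refine Finset.sum_congr rfl fun μ hμ => ?_
  have hn := norm_eq_one_of_pow_orderOf (hs μ hμ).2
  have h0 : μ ≠ 0 := by rintro rfl; simp at hn
  rw [map_mul, map_natCast, ← Complex.inv_eq_conj hn]
  congr 1
  refine eq_inv_of_mul_eq_one_left ?_
  rw [← pow_succ, Nat.sub_add_cancel (orderOf_pos g), (hs μ hμ).2]

/-- Equality case of the triangle inequality: a sum of `dim V` roots of unity equals `dim V` only if
all of them are `1`. Hence kernels are visible in the character table. -/
theorem Representation.eq_one_of_character_eq (g : G) (hg : ρ.character g = ρ.character 1) :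
    ρ g = 1 := by
  obtain ⟨s, hs, h⟩ := ρ.character_pow_eq_sum_eigenvalues g
  have h0 := h 0
  have h1 := h 1
  simp only [pow_one, pow_zero, mul_one] at h1 h0
  have hre : ∀ μ ∈ s, μ.re ≤ 1 := fun μ hμ =>
    (Complex.re_le_norm μ).trans (norm_eq_one_of_pow_orderOf (hs μ hμ).2).le
  have hsum : ∑ μ ∈ s, (finrank ℂ (Module.End.eigenspace (ρ g) μ) : ℝ) * (1 - μ.re) = 0 := by
    have := congrArg Complex.re (h0.symm.trans (hg.symm.trans h1))
    simp only [Complex.re_sum, Complex.mul_re, Complex.natCast_re, Complex.natCast_im] at this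
    simp only [mul_sub, Finset.sum_sub_distrib, mul_one]
    simp only [zero_mul, sub_zero] at this
    linarith
  have hall := (Finset.sum_eq_zero_iff_of_nonneg fun μ hμ =>
    mul_nonneg (Nat.cast_nonneg _) (sub_nonneg.2 (hre μ hμ))).1 hsum
  have hone : ∀ μ ∈ s, μ = 1 := by
    intro μ hμ
    have hpos : finrank ℂ (Module.End.eigenspace (ρ g) μ) ≠ 0 := by
      rw [Ne, Submodule.finrank_eq_zero]
      exact (hs μ hμ).1
    have hr : μ.re = 1 := by
      rcases mul_eq_zero.1 (hall μ hμ) with h | h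
      · exact absurd (by exact_mod_cast h) hpos
      · linarith
    have hn := norm_eq_one_of_pow_orderOf (hs μ hμ).2
    have := Complex.sq_norm_sub_sq_re μ
    rw [hn, hr] at this
    apply Complex.ext
    · simpa using hr
    · have : μ.im ^ 2 = 0 := by linarith
      simpa using this
  have htop : finrank ℂ (Module.End.eigenspace (ρ g) 1) = finrank ℂ V := by
    rw [ρ.char_one] at h0
    have hle := Submodule.finrank_le (Module.End.eigenspace (ρ g) 1)
    refine le_antisymm hle ?_
    have : (finrank ℂ V : ℂ) = ((∑ μ ∈ s, finrank ℂ (Module.End.eigenspace (ρ g) μ) : ℕ) : ℂ) := by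
      rw [h0]; push_cast; rfl
    rw [Nat.cast_inj.1 this]
    calc ∑ μ ∈ s, finrank ℂ (Module.End.eigenspace (ρ g) μ)
        ≤ ∑ μ ∈ ({1} : Finset ℂ), finrank ℂ (Module.End.eigenspace (ρ g) μ) :=
          Finset.sum_le_sum_of_subset fun μ hμ => by simpa using hone μ hμ
      _ = _ := by simp
  have := Submodule.eq_top_of_finrank_eq htop
  ext v
  have hv : v ∈ Module.End.eigenspace (ρ g) 1 := by rw [this]; trivial
  simpa using Module.End.mem_eigenspace_iff.1 hv

end character

/-! ### Irreducible characters and the orthogonality relations. -/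

section irr
open Module

namespace Representation
variable {G : Type*} [Group G] {V W : Type*} [AddCommGroup V] [Module ℂ V]
  [AddCommGroup W] [Module ℂ W]

theorem isIrreducible_iff_forall_submodule (ρ : Representation ℂ G V) :
    ρ.IsIrreducible ↔ Nontrivial V ∧
      ∀ U : Submodule ℂ V, (∀ g, ∀ v ∈ U, ρ g v ∈ U) → U = ⊥ ∨ U = ⊤ := by
  constructor
  · intro h
    refine ⟨?_, fun U hU => ?_⟩
    · by_contra hV
      rw [not_nontrivial_iff_subsingleton] at hV
      apply (bot_ne_top : (⊥ : Subrepresentation ρ) ≠ ⊤)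
      apply Subrepresentation.toSubmodule_injective
      exact Subsingleton.elim _ _
    · rcases eq_bot_or_eq_top (⟨U, hU⟩ : Subrepresentation ρ) with h | h
      · exact Or.inl (congrArg Subrepresentation.toSubmodule h)
      · exact Or.inr (congrArg Subrepresentation.toSubmodule h)
  · rintro ⟨hV, h⟩
    refine { exists_pair_ne := ⟨⊥, ⊤, fun e => ?_⟩, eq_bot_or_eq_top := fun U => ?_ }
    · exact bot_ne_top (congrArg Subrepresentation.toSubmodule e : (⊥ : Submodule ℂ V) = ⊤)
    · rcases h U.toSubmodule (fun g v hv => U.apply_mem_toSubmodule g hv) with h | h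
      · exact Or.inl (Subrepresentation.toSubmodule_injective h)
      · exact Or.inr (Subrepresentation.toSubmodule_injective h)

theorem IsIrreducible.of_linearEquiv {ρ : Representation ℂ G V} {σ : Representation ℂ G W}
    (h : ρ.IsIrreducible) (e : V ≃ₗ[ℂ] W) (he : ∀ g v, e (ρ g v) = σ g (e v)) :
    σ.IsIrreducible := by
  rw [isIrreducible_iff_forall_submodule] at h ⊢
  obtain ⟨hV, h⟩ := h
  refine ⟨e.symm.toEquiv.nontrivial, fun U hU => ?_⟩
  rcases h (U.comap e.toLinearMap) (fun g v hv => by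
    simp only [Submodule.mem_comap, LinearEquiv.coe_coe] at hv ⊢
    rw [he]; exact hU g _ hv) with h | h
  · left
    rw [eq_bot_iff]
    intro w hw
    have : e.symm w ∈ U.comap e.toLinearMap := by simpa using hw
    rw [h] at this
    simpa using this
  · right
    rw [eq_top_iff]
    intro w _
    have : e.symm w ∈ U.comap e.toLinearMap := by rw [h]; trivial
    simpa using this

theorem IsIrreducible.character_mem_irr [FiniteDimensional ℂ V] {ρ : Representation ℂ G V}
    (h : ρ.IsIrreducible) : ρ.character ∈ Irr G := by
  let e : V ≃ₗ[ℂ] (Fin (finrank ℂ V) → ℂ) := (finBasis ℂ V).equivFun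
  let σ : Representation ℂ G (Fin (finrank ℂ V) → ℂ) :=
    { toFun := fun g => e.conj (ρ g)
      map_one' := by ext; simp [LinearEquiv.conj_apply]
      map_mul' := fun a b => by ext; simp [LinearEquiv.conj_apply] }
  refine ⟨_, σ, h.of_linearEquiv e fun g v => ?_, ?_⟩
  · change _ = e.conj (ρ g) (e v)
    simp [LinearEquiv.conj_apply]
  · ext g
    exact LinearMap.trace_conj' (ρ g) e

end Representation

variable {G : Type*} [Group G]

theorem Irr.character_apply_conj (χ : Irr G) (a t : G) : χ.1 (t * a * t⁻¹) = χ.1 a :=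
  (Irr.apply_eq_of_isConj χ _ _ (isConj_iff.2 ⟨t, rfl⟩)).symm

theorem Irr.exists_apply_one (χ : Irr G) : ∃ n : ℕ, 0 < n ∧ χ.1 1 = n := by
  obtain ⟨χ, n, ρ, hρ, rfl⟩ := χ
  refine ⟨n, ?_, by simp [Representation.char_one]⟩
  have := ((Representation.isIrreducible_iff_forall_submodule ρ).1 hρ).1
  rcases Nat.eq_zero_or_pos n with rfl | h
  · exact (not_subsingleton (Fin 0 → ℂ) inferInstance).elim
  · exact h

/-- A class function orthogonal to all the irreducible characters annihilates, through its
average, every finite-dimensional representation. -/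
theorem Representation.sum_smul_eq_zero_of_orthogonal [Fintype G] (f : G → ℂ)
    (hf : ∀ a t, f (t * a * t⁻¹) = f a)
    (horth : ∀ χ : Irr G, ∑ g, f g * χ.1 g⁻¹ = 0) (d : ℕ) :
    ∀ {V : Type*} [AddCommGroup V] [Module ℂ V] [FiniteDimensional ℂ V]
      (ρ : Representation ℂ G V), finrank ℂ V = d → ∑ g, f g • ρ g⁻¹ = 0 := by
  induction d using Nat.strong_induction_on with
  | _ d ih =>
  intro V _ _ _ ρ hd
  by_cases hirr : ρ.IsIrreducible
  -- By Schur the average is a scalar, and orthogonality to the character of `ρ` makes its trace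
  -- zero.
  · let F : Representation.IntertwiningMap ρ ρ :=
      ⟨∑ g, f g • ρ g⁻¹, fun h => by
        change (∑ g, f g • ρ g⁻¹) * ρ h = ρ h * ∑ g, f g • ρ g⁻¹
        rw [Finset.sum_mul, Finset.mul_sum]
        simp only [smul_mul_assoc, mul_smul_comm]
        rw [← Equiv.sum_comp (MulAut.conj h).toEquiv]
        refine Finset.sum_congr rfl fun g _ => ?_
        change f (h * g * h⁻¹) • (ρ (h * g * h⁻¹)⁻¹ * ρ h) = _
        rw [hf, ← map_mul, ← map_mul]
        congr 2
        group⟩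
    obtain ⟨c, hc⟩ :=
      (Representation.IsIrreducible.algebraMap_intertwiningMap_bijective_of_isAlgClosed).2 F
    have hF : ∑ g, f g • ρ g⁻¹ = c • (LinearMap.id : V →ₗ[ℂ] V) := by
      have := congrArg Representation.IntertwiningMap.toLinearMap hc
      rw [Representation.IntertwiningMap.algebraMap_apply] at this
      exact this.symm
    have htr := congrArg (LinearMap.trace ℂ V) hF
    rw [map_sum, map_smul, LinearMap.trace_id, smul_eq_mul] at htr
    simp only [map_smul, smul_eq_mul] at htr
    have h0 : c * (finrank ℂ V : ℂ) = 0 := htr ▸ horth ⟨_, hirr.character_mem_irr⟩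
    have hV := ((Representation.isIrreducible_iff_forall_submodule ρ).1 hirr).1
    have : (finrank ℂ V : ℂ) ≠ 0 := by exact_mod_cast (finrank_pos (R := ℂ) (M := V)).ne'
    rw [hF, (mul_eq_zero.1 h0).resolve_right this, zero_smul]
  · rw [isIrreducible_iff_forall_submodule, not_and_or, not_nontrivial_iff_subsingleton] at hirr
    rcases hirr with hV | hU
    · exact Subsingleton.elim _ _
    · push Not at hU
      obtain ⟨U, hU, hbot, htop⟩ := hU
      let A : Subrepresentation ρ := ⟨U, hU⟩
      -- Maschke: the average vanishes on both proper summands by induction.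
      obtain ⟨B, hB⟩ := exists_isCompl A
      have hsub : ∀ C : Subrepresentation ρ, C.toSubmodule ≠ ⊤ →
          ∀ v ∈ C.toSubmodule, (∑ g, f g • ρ g⁻¹) v = 0 := by
        intro C hC v hv
        have hlt : finrank ℂ C.toSubmodule < d := hd ▸ Submodule.finrank_lt hC
        have := congrArg (fun φ => ((φ ⟨v, hv⟩ : C.toSubmodule) : V))
          (ih _ hlt C.toRepresentation rfl)
        simpa [LinearMap.sum_apply, Subrepresentation.toRepresentation] using this
      have hinf : A.toSubmodule ⊓ B.toSubmodule = ⊥ :=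
        congrArg Subrepresentation.toSubmodule hB.inf_eq_bot
      have hsup : A.toSubmodule ⊔ B.toSubmodule = ⊤ :=
        congrArg Subrepresentation.toSubmodule hB.sup_eq_top
      have hBtop : B.toSubmodule ≠ ⊤ := by
        intro h
        rw [h, inf_top_eq] at hinf
        exact hbot hinf
      ext v
      have hv : v ∈ A.toSubmodule ⊔ B.toSubmodule := by rw [hsup]; trivial
      obtain ⟨a, ha, b, hb, rfl⟩ := Submodule.mem_sup.1 hv
      rw [map_add, hsub A htop a ha, hsub B hBtop b hb]
      simp

theorem Irr.eq_zero_of_orthogonal [Fintype G] (f : G → ℂ)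
    (hf : ∀ a t, f (t * a * t⁻¹) = f a)
    (horth : ∀ χ : Irr G, ∑ g, f g * χ.1 g⁻¹ = 0) : f = 0 := by
  classical
  have h := Representation.sum_smul_eq_zero_of_orthogonal f hf horth _
    (Representation.ofMulAction ℂ G G) rfl
  ext a
  -- In the regular representation the average sends the basis vector `1` to `∑ g, f g • g⁻¹`, whose
  -- coefficient at `a⁻¹` is `f a`.
  have h1 := congrArg (fun φ => (φ (MonoidAlgebra.single 1 1)).coeff a⁻¹) h
  simpa [LinearMap.sum_apply, Finsupp.single_apply] using h1

theorem Irr.sum_mul_inv [Fintype G] [DecidableEq (Irr G)] (χ ψ : Irr G) :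
    ∑ g, χ.1 g * ψ.1 g⁻¹ = if χ = ψ then (Nat.card G : ℂ) else 0 := by
  have hc : (Nat.card G : ℂ) ≠ 0 := by exact_mod_cast Nat.card_pos.ne'
  let _ : Invertible (Nat.card G : ℂ) := invertibleOfNonzero hc
  obtain ⟨_, n, ρ, hρ, rfl⟩ := χ
  obtain ⟨_, m, σ, hσ, rfl⟩ := ψ
  have key := Representation.char_orthonormal ρ σ
  split_ifs with h
  · have h2 := Representation.char_orthonormal ρ ρ
    rw [if_pos ⟨Representation.Equiv.refl ρ⟩] at h2
    have h' : ρ.character = σ.character := congrArg Subtype.val h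
    rw [inv_mul_eq_one₀ hc] at h2
    simpa only [← h'] using h2.symm
  · rw [if_neg] at key
    · simpa [hc] using key
    · rintro ⟨e⟩
      exact h (Subtype.ext (Representation.char_iso e).symm)

instance Irr.finite [Finite G] : Finite (Irr G) := by
  classical
  cases nonempty_fintype G
  have hli : LinearIndependent ℂ (fun χ : Irr G => χ.1) := by
    rw [linearIndependent_iff']
    intro s c hs ψ hψ
    have h1 : ∑ g, (∑ χ ∈ s, c χ • χ.1) g * ψ.1 g⁻¹ = 0 := by rw [hs]; simp
    simp only [Finset.sum_apply, Pi.smul_apply, smul_eq_mul, Finset.sum_mul] at h1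
    rw [Finset.sum_comm] at h1
    simp only [mul_assoc, ← Finset.mul_sum, Irr.sum_mul_inv] at h1
    simp only [mul_ite, mul_zero, Finset.sum_ite_eq', hψ, if_true] at h1
    exact (mul_eq_zero.1 h1).resolve_right (by exact_mod_cast Nat.card_pos.ne')
  exact hli.finite

noncomputable instance Irr.fintype [Finite G] : Fintype (Irr G) := Fintype.ofFinite _

/-- Column orthogonality. -/
theorem Irr.sum_inv_mul [Finite G] (x g : G) :
    ∑ χ : Irr G, χ.1 x⁻¹ * χ.1 g = Nat.card {t : G // t * x * t⁻¹ = g} := by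
  classical
  cases nonempty_fintype G
  have hcard : ∀ g, (Nat.card {t : G // t * x * t⁻¹ = g} : ℂ)
      = ∑ t : G, if t * x * t⁻¹ = g then 1 else 0 := fun g => by
    rw [Nat.card_eq_fintype_card, Fintype.card_subtype, Finset.sum_boole]
  -- The difference of the two sides is a class function of `g`; row orthogonality shows that it is
  -- orthogonal to every irreducible character.
  have key := Irr.eq_zero_of_orthogonal
    (fun g => (∑ t : G, if t * x * t⁻¹ = g then (1 : ℂ) else 0) - ∑ χ : Irr G, χ.1 x⁻¹ * χ.1 g)
    ?_ ?_
  · have := congrFun key g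
    rw [hcard]
    exact (sub_eq_zero.1 this).symm
  · intro a s
    simp only [Irr.character_apply_conj]
    congr 1
    rw [← Equiv.sum_comp (Equiv.mulLeft s)]
    refine Finset.sum_congr rfl fun t _ => if_congr ?_ rfl rfl
    simp only [Equiv.coe_mulLeft, mul_inv_rev]
    constructor
    · intro h
      simpa [mul_assoc] using congrArg (fun z => s⁻¹ * z * s) h
    · rintro rfl
      group
  · intro ψ
    simp only [sub_mul, Finset.sum_sub_distrib, Finset.sum_mul, ite_mul, one_mul, zero_mul]
    rw [Finset.sum_comm, Finset.sum_comm (t := (Finset.univ : Finset (Irr G)))]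
    simp only [mul_assoc, ← Finset.mul_sum, Irr.sum_mul_inv]
    simp only [Finset.sum_ite_eq, Finset.mem_univ, if_true, mul_ite, mul_zero, Finset.sum_ite_eq']
    have : ∀ t : G, ψ.1 (t * (x * t⁻¹))⁻¹ = ψ.1 x⁻¹ := fun t => by
      rw [← Irr.character_apply_conj ψ x⁻¹ t]
      group
    simp only [this, Finset.sum_const, Finset.card_univ, nsmul_eq_mul, Nat.card_eq_fintype_card]
    ring

end irr

/-! ### What the character table determines: centralizers, normal subgroups, quotients. -/

section table

variable {G H : Type*} [Group G] [Group H]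

theorem Irr.apply_inv [Finite G] (χ : Irr G) (g : G) : χ.1 g⁻¹ = starRingEnd ℂ (χ.1 g) := by
  obtain ⟨_, n, ρ, -, rfl⟩ := χ
  exact ρ.character_inv_eq_conj g

theorem Irr.apply_mul_of_apply_eq [Finite G] (χ : Irr G) {a : G} (ha : χ.1 a = χ.1 1) (b : G) :
    χ.1 (a * b) = χ.1 b := by
  obtain ⟨n, ρ, -, hρ⟩ := χ.2
  simp only [← hρ] at ha ⊢
  simp only [Representation.character, map_mul, ρ.eq_one_of_character_eq a ha, one_mul]

theorem Representation.IsIrreducible.comp_iff_of_surjective {V : Type*} [AddCommGroup V]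
    [Module ℂ V] (ρ : Representation ℂ H V) {f : G →* H} (hf : Function.Surjective f) :
    Representation.IsIrreducible (ρ.comp f : Representation ℂ G V) ↔ ρ.IsIrreducible := by
  rw [isIrreducible_iff_forall_submodule, isIrreducible_iff_forall_submodule]
  refine and_congr_right fun _ => forall_congr' fun U => imp_congr_left ?_
  exact ⟨fun h b => by obtain ⟨a, rfl⟩ := hf b; exact h a, fun h a => h (f a)⟩

/-- Inflation identifies the irreducible characters of a quotient with the irreducible characters
whose kernel contains the normal subgroup. -/
noncomputable def Irr.quotientEquiv [Finite G] (N : Subgroup G) [N.Normal] :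
    Irr (G ⧸ N) ≃ {χ : Irr G // ∀ n ∈ N, χ.1 n = χ.1 1} :=
  Equiv.ofBijective
    (fun χ => ⟨⟨fun g => χ.1 (g : G ⧸ N), by
        obtain ⟨χ, n, ρ, hρ, rfl⟩ := χ
        exact ⟨n, ρ.comp (QuotientGroup.mk' N),
          (Representation.IsIrreducible.comp_iff_of_surjective ρ
            (QuotientGroup.mk'_surjective N)).2 hρ, rfl⟩⟩,
      fun n hn => congrArg χ.1 ((QuotientGroup.eq_one_iff n).2 hn)⟩)
    (by
      constructor
      · intro χ ψ h
        ext a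
        obtain ⟨g, rfl⟩ := QuotientGroup.mk_surjective a
        exact congrFun (congrArg (fun z => z.1.1) h) g
      · rintro ⟨⟨_, n, ρ, hρ, rfl⟩, hχ⟩
        let σ : Representation ℂ (G ⧸ N) (Fin n → ℂ) :=
          QuotientGroup.lift N ρ fun a ha => ρ.eq_one_of_character_eq a (hχ a ha)
        have hσ : (σ.comp (QuotientGroup.mk' N) : Representation ℂ G (Fin n → ℂ)) = ρ := by
          ext1 g; rfl
        exact ⟨⟨σ.character, n, σ, (Representation.IsIrreducible.comp_iff_of_surjective σ
          (QuotientGroup.mk'_surjective N)).1 (by rw [hσ]; exact hρ), rfl⟩, rfl⟩)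

@[simp]
theorem Irr.quotientEquiv_apply [Finite G] (N : Subgroup G) [N.Normal] (χ : Irr (G ⧸ N)) (g : G) :
    (Irr.quotientEquiv N χ).1.1 g = χ.1 (g : G ⧸ N) := rfl

/-- A correspondence of the character tables of `G` and `H`: a bijection between the irreducible
characters, and a relation between the elements, total on both sides, along which the characters
take the same values. -/
structure TableCorr (G H : Type*) [Group G] [Group H] where
  rows : Irr G ≃ Irr H
  rel : G → H → Prop
  left_total : ∀ x, ∃ y, rel x y
  right_total : ∀ y, ∃ x, rel x y
  entry : ∀ (χ : Irr G) {x : G} {y : H}, rel x y → (rows χ).1 y = χ.1 x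

/-- The correspondence given by an identification of character tables. -/
def CharacterTableIso.toCorr (T : CharacterTableIso G H) : TableCorr G H where
  rows := T.rows
  rel x y := T.cols (ConjClasses.mk x) = ConjClasses.mk y
  left_total x := by
    obtain ⟨y, hy⟩ := ConjClasses.mk_surjective (T.cols (ConjClasses.mk x))
    exact ⟨y, hy.symm⟩
  right_total y := by
    obtain ⟨x, hx⟩ := ConjClasses.mk_surjective (T.cols.symm (ConjClasses.mk y))
    exact ⟨x, by rw [hx, Equiv.apply_symm_apply]⟩
  entry χ x y h := by
    have := T.entry χ (ConjClasses.mk x)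
    rw [h] at this
    exact this

/-- The order of the centralizer of `x`. -/
noncomputable def centralizerCard (x : G) : ℕ := Nat.card {t : G // t * x * t⁻¹ = x}

theorem centralizerCard_one : centralizerCard (1 : G) = Nat.card G :=
  Nat.card_congr (Equiv.subtypeUnivEquiv fun t => by simp)

namespace TableCorr

variable [Finite G]

/-- Let `x` be related to `1`. All the values `χ x` are then degrees of characters of `H`, so `∑ χ 1
* χ x` is positive, and column orthogonality makes `x` conjugate to `1`. -/
theorem rel_one (T : TableCorr G H) : T.rel 1 1 := by
  obtain ⟨x, hx⟩ := T.right_total 1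
  have h1 := Irr.sum_inv_mul 1 x
  choose d hd hd' using fun χ : Irr G => Irr.exists_apply_one χ
  choose e he he' using fun χ : Irr H => Irr.exists_apply_one χ
  simp only [inv_one, hd', ← T.entry _ hx, he'] at h1
  have hne : Nonempty (Irr G) := by
    by_contra hemp
    rw [not_nonempty_iff] at hemp
    have h2 := Irr.sum_inv_mul (1 : G) 1
    rw [Finset.univ_eq_empty, Finset.sum_empty] at h2
    have : Nonempty {t : G // t * 1 * t⁻¹ = 1} := ⟨⟨1, by simp⟩⟩
    exact Nat.card_pos.ne' (by exact_mod_cast h2.symm)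
  have hpos : 0 < ∑ χ : Irr G, d χ * e (T.rows χ) :=
    Finset.sum_pos (fun χ _ => Nat.mul_pos (hd χ) (he _)) Finset.univ_nonempty
  have h3 : ∑ χ : Irr G, d χ * e (T.rows χ) = Nat.card {t : G // t * 1 * t⁻¹ = x} := by
    exact_mod_cast h1
  rw [h3] at hpos
  obtain ⟨⟨t, ht⟩⟩ := (Nat.card_pos_iff.1 hpos).1
  have : x = 1 := by rw [← ht]; simp
  rwa [this] at hx

theorem rows_apply_one (T : TableCorr G H) (χ : Irr G) : (T.rows χ).1 1 = χ.1 1 :=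
  T.entry χ T.rel_one

variable [Finite H] (T : TableCorr G H)

/-- By column orthogonality, a centralizer order is the sum of the squared absolute values in a
column. -/
theorem centralizerCard_eq {x : G} {y : H} (h : T.rel x y) :
    centralizerCard x = centralizerCard y := by
  have h1 := Irr.sum_inv_mul x x
  have h2 := Irr.sum_inv_mul y y
  rw [← Equiv.sum_comp T.rows] at h2
  simp only [Irr.apply_inv, T.entry _ h] at h1 h2
  exact_mod_cast h1.symm.trans h2

theorem card_eq (T : TableCorr G H) : Nat.card G = Nat.card H := by
  have h := T.centralizerCard_eq T.rel_one
  rwa [centralizerCard_one, centralizerCard_one] at h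

/-- The normal subgroup of `H` that corresponds to a normal subgroup of `G`. -/
def mapNormal (N : Subgroup G) : Subgroup H where
  carrier := {y | ∀ χ : Irr G, (∀ n ∈ N, χ.1 n = χ.1 1) → (T.rows χ).1 y = (T.rows χ).1 1}
  one_mem' _ _ := rfl
  mul_mem' {a b} ha hb χ hχ := by
    rw [Irr.apply_mul_of_apply_eq _ (ha χ hχ), hb χ hχ]
  inv_mem' {a} ha χ hχ := by
    rw [← Irr.apply_mul_of_apply_eq _ (ha χ hχ), mul_inv_cancel]

instance mapNormal_normal (N : Subgroup G) : (T.mapNormal N).Normal :=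
  ⟨fun a ha t χ hχ => by rw [Irr.character_apply_conj]; exact ha χ hχ⟩

theorem mem_kernel_iff (N : Subgroup G) (χ : Irr G) :
    (∀ n ∈ N, χ.1 n = χ.1 1) ↔
      ∀ y ∈ T.mapNormal N, (T.rows χ).1 y = (T.rows χ).1 1 := by
  refine ⟨fun h y hy => hy χ h, fun h x hx => ?_⟩
  obtain ⟨y, hy⟩ := T.left_total x
  rw [← T.entry χ hy, ← T.rows_apply_one]
  refine h y fun ψ hψ => ?_
  rw [T.entry ψ hy, T.rows_apply_one, hψ x hx]

/-- The induced correspondence of the character tables of the quotients. -/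
noncomputable def quotient (N : Subgroup G) [N.Normal] :
    TableCorr (G ⧸ N) (H ⧸ T.mapNormal N) where
  rows := (Irr.quotientEquiv N).trans
    ((T.rows.subtypeEquiv (T.mem_kernel_iff N)).trans (Irr.quotientEquiv (T.mapNormal N)).symm)
  -- Since columns are matched only by a total relation, images of related pairs suffice; no
  -- bijection between the classes of the quotients has to be built.
  rel a b := ∃ x y, T.rel x y ∧ (x : G ⧸ N) = a ∧ (y : H ⧸ T.mapNormal N) = b
  left_total a := by
    obtain ⟨x, rfl⟩ := QuotientGroup.mk_surjective a
    obtain ⟨y, hy⟩ := T.left_total x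
    exact ⟨_, x, y, hy, rfl, rfl⟩
  right_total b := by
    obtain ⟨y, rfl⟩ := QuotientGroup.mk_surjective b
    obtain ⟨x, hx⟩ := T.right_total y
    exact ⟨_, x, y, hx, rfl, rfl⟩
  entry χ a b := by
    rintro ⟨x, y, h, rfl, rfl⟩
    rw [← Irr.quotientEquiv_apply (T.mapNormal N)]
    simp only [Equiv.trans_apply, Equiv.apply_symm_apply, Equiv.subtypeEquiv_apply]
    rw [T.entry _ h, Irr.quotientEquiv_apply]

theorem quotient_rel (N : Subgroup G) [N.Normal] {x : G} {y : H} (h : T.rel x y) :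
    (T.quotient N).rel (x : G ⧸ N) (y : H ⧸ T.mapNormal N) := ⟨x, y, h, rfl, rfl⟩

theorem card_mapNormal (N : Subgroup G) [N.Normal] :
    Nat.card (T.mapNormal N) = Nat.card N := by
  have h1 := Subgroup.card_eq_card_quotient_mul_card_subgroup N
  have h2 := Subgroup.card_eq_card_quotient_mul_card_subgroup (T.mapNormal N)
  rw [← T.card_eq, ← (T.quotient N).card_eq, h1] at h2
  exact (Nat.eq_of_mul_eq_mul_left Nat.card_pos h2).symm

end TableCorr
end table

/-! ### Algebraic integers modulo a prime over `p`. -/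

section integrality

/-- A reduction of the ring of algebraic integers to a field of characteristic `p`. -/
theorem exists_reduction_algebraicIntegers (p : ℕ) [hp : Fact p.Prime] :
    ∃ P : Ideal (integralClosure ℤ ℂ), P.IsMaximal ∧
      CharP (integralClosure ℤ ℂ ⧸ P) p := by
  have hnu : (p : integralClosure ℤ ℂ) ∈ nonunits (integralClosure ℤ ℂ) := by
    intro hu
    obtain ⟨u, hu⟩ := hu.exists_right_inv
    have h1 : (p : ℂ) * (u : ℂ) = 1 := by
      simpa using congrArg (Subtype.val) hu
    have hpc : (p : ℂ) ≠ 0 := by exact_mod_cast hp.1.ne_zero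
    have h2 : (u : ℂ) = algebraMap ℚ ℂ (p : ℚ)⁻¹ := by
      rw [map_inv₀, map_natCast]
      exact eq_inv_of_mul_eq_one_right h1
    have h3 : IsIntegral ℤ (p : ℚ)⁻¹ := by
      have := u.2
      rw [mem_integralClosure_iff, h2] at this
      exact (isIntegral_algebraMap_iff (algebraMap ℚ ℂ).injective).1 this
    obtain ⟨z, hz⟩ := IsIntegrallyClosed.isIntegral_iff.1 h3
    have hpq : (p : ℚ) ≠ 0 := by exact_mod_cast hp.1.ne_zero
    have h4 : (z : ℚ) * p = 1 := by
      rw [show (z : ℚ) = (p : ℚ)⁻¹ from hz, inv_mul_cancel₀ hpq]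
    have h5 : z * p = 1 := by exact_mod_cast h4
    have h6 : (p : ℤ) ∣ 1 := ⟨z, by rw [mul_comm]; exact h5.symm⟩
    exact hp.1.one_lt.ne' (by exact_mod_cast Int.eq_one_of_dvd_one (by positivity) h6)
  obtain ⟨P, hP, hpP⟩ := exists_max_ideal_of_mem_nonunits hnu
  refine ⟨P, hP, ?_⟩
  have : (p : integralClosure ℤ ℂ ⧸ P) = 0 := by
    rw [← map_natCast (Ideal.Quotient.mk P)]
    exact Ideal.Quotient.eq_zero_iff_mem.2 hpP
  exact (CharP.charP_iff_prime_eq_zero hp.1).2 this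

/-- The average is the trace of `ρ a * E`, where `E` is the projection onto the `Q`-fixed vectors.
As `a` commutes with `Q`, this product satisfies `f ^ (m + 1) = f` with `m` the order of `a`, so
dividing by `|Q|` preserves integrality. -/
theorem integral_average_character {G V : Type*} [Group G] [Finite G] [AddCommGroup V]
    [Module ℂ V] [FiniteDimensional ℂ V] (ρ : Representation ℂ G V) (Q : Subgroup G) [Fintype Q]
    (a : G) (ha : ∀ q ∈ Q, Commute a q) :
    IsIntegral ℤ ((Nat.card Q : ℂ)⁻¹ * ∑ q : Q, ρ.character (a * q)) := by
  set E : Module.End ℂ V := (Nat.card Q : ℂ)⁻¹ • ∑ q : Q, ρ q with hE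
  have hc : (Nat.card Q : ℂ) ≠ 0 := by exact_mod_cast Nat.card_pos.ne'
  have hmul : ∀ q : Q, ρ q * E = E := fun q => by
    rw [hE, mul_smul_comm, Finset.mul_sum]
    congr 1
    rw [← Equiv.sum_comp (Equiv.mulLeft q) (fun r : Q => ρ r)]
    simp
  have hidem : E * E = E := by
    nth_rewrite 1 [hE]
    rw [smul_mul_assoc, Finset.sum_mul]
    simp only [hmul, Finset.sum_const, Finset.card_univ]
    rw [← Nat.card_eq_fintype_card, ← Nat.cast_smul_eq_nsmul ℂ, smul_smul, inv_mul_cancel₀ hc,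
      one_smul]
  have hcomm : Commute (ρ a) E := by
    refine Commute.smul_right ?_ _
    refine Commute.sum_right _ _ _ fun q _ => ?_
    exact (ha q q.2).map ρ
  have htr : (Nat.card Q : ℂ)⁻¹ * ∑ q : Q, ρ.character (a * q) =
      LinearMap.trace ℂ V (ρ a * E) := by
    simp only [hE, mul_smul_comm, map_smul, smul_eq_mul, Finset.mul_sum, map_sum,
      Representation.character, map_mul]
  rw [htr]
  refine trace_isIntegral_of_pow_succ_eq _ (orderOf_pos a) ?_
  have hp : ∀ k : ℕ, E ^ (k + 1) = E := fun k => by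
    induction k with
    | zero => simp
    | succ k ih => rw [pow_succ, ih, hidem]
  rw [hcomm.mul_pow, hp, ← map_pow, pow_succ, pow_orderOf_eq_one, one_mul]

end integrality

/-! ### Recognizing the `p`-elements from the character table. -/

section pElement

variable {G : Type*} [Group G] [Finite G]

theorem Irr.isIntegral_apply (χ : Irr G) (g : G) : IsIntegral ℤ (χ.1 g) := by
  obtain ⟨_, n, ρ, -, rfl⟩ := χ
  exact trace_isIntegral_of_pow_succ_eq (ρ g) (orderOf_pos g)
    (by rw [← map_pow, pow_succ, pow_orderOf_eq_one, one_mul])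

/-- The value of an irreducible character, as an algebraic integer. -/
noncomputable def Irr.value (χ : Irr G) (g : G) : integralClosure ℤ ℂ :=
  ⟨χ.1 g, Irr.isIntegral_apply χ g⟩

variable {p : ℕ} [Fact p.Prime] {k : Type*} [Field k] [CharP k p]
  (φ : integralClosure ℤ ℂ →+* k)

/-- In characteristic `p`, raising the eigenvalues to the power `p ^ j` is Frobenius applied to
their sum, because the multiplicities lie in the prime field. -/
theorem Irr.reduction_pow (χ : Irr G) (g : G) (j : ℕ) :
    φ (Irr.value χ (g ^ p ^ j)) = iterateFrobenius k p j (φ (Irr.value χ g)) := by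
  obtain ⟨_, n, ρ, hρ, rfl⟩ := χ
  obtain ⟨s, hs, h⟩ := ρ.character_pow_eq_sum_eigenvalues g
  have hint : ∀ μ ∈ s, IsIntegral ℤ μ := fun μ hμ =>
    IsIntegral.of_pow (orderOf_pos g) (by rw [(hs μ hμ).2]; exact isIntegral_one)
  let χ : Irr G := ⟨ρ.character, n, ρ, hρ, rfl⟩
  have hval : ∀ i : ℕ, Irr.value χ (g ^ i) = ∑ μ : s,
      (Module.finrank ℂ (Module.End.eigenspace (ρ g) μ.1) : integralClosure ℤ ℂ) *
        (⟨μ.1, hint μ.1 μ.2⟩ : integralClosure ℤ ℂ) ^ i := by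
    intro i
    apply Subtype.ext
    have h2 : (Irr.value χ (g ^ i)).1 = ρ.character (g ^ i) := rfl
    rw [h2, h i, ← Finset.sum_coe_sort s]
    push_cast
    rfl
  have h1 := hval 1
  rw [pow_one] at h1
  change φ (Irr.value χ (g ^ p ^ j)) = iterateFrobenius k p j (φ (Irr.value χ g))
  rw [hval, h1]
  simp only [map_sum, map_mul, map_natCast, map_pow, pow_one]
  simp only [iterateFrobenius_def]

theorem Irr.reduction_one_fixed (χ : Irr G) (j : ℕ) :
    iterateFrobenius k p j (φ (Irr.value χ 1)) = φ (Irr.value χ 1) := by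
  rw [← Irr.reduction_pow, one_pow]

/-- Suppose `s ≠ 1` and let `Q` be a Sylow `p`-subgroup of its centralizer `C`. Averaging column
orthogonality over the coset `s * Q` gives algebraic integers `a_χ` with `∑ a_χ * (χ s - χ 1) = |C :
Q|`. The left side reduces to zero, while `p` does not divide the index. -/
theorem eq_one_of_coprime_of_reduction_eq {s : G} (hs : (orderOf s).Coprime p)
    (h : ∀ χ : Irr G, φ (Irr.value χ s) = φ (Irr.value χ 1)) : s = 1 := by
  classical
  have hp : p.Prime := Fact.out
  by_contra hne
  cases nonempty_fintype G
  let C : Subgroup G := Subgroup.centralizer {s}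
  let S : Sylow p C := default
  let Q : Subgroup G := (S : Subgroup C).map C.subtype
  have hQp : IsPGroup p Q := S.2.map _
  have hcard : Nat.card Q = Nat.card S :=
    Subgroup.card_map_of_injective C.subtype_injective
  have hcomm : ∀ q ∈ Q, Commute s q := by
    rintro _ ⟨c, -, rfl⟩
    exact (Subgroup.mem_centralizer_singleton_iff.1 c.2).symm
  have hCcard : centralizerCard s = Nat.card C := by
    refine Nat.card_congr (Equiv.subtypeEquivRight fun t => ?_)
    rw [Subgroup.mem_centralizer_singleton_iff, mul_inv_eq_iff_eq_mul, eq_comm]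
  have hcop : ∀ q : Q, (orderOf s).Coprime (orderOf q) := fun q => by
    obtain ⟨j, hj⟩ := (IsPGroup.iff_orderOf.1 hQp) q
    rw [hj]
    exact hs.pow_right j
  -- As `s` and `q` commute and have coprime orders, `s * q` is conjugate to `s` only for `q = 1`,
  -- and never to `1`.
  have hnum : ∀ q : Q, Nat.card {t : G // t * (s * q) * t⁻¹ = s} =
      if q = 1 then Nat.card C else 0 := by
    intro q
    split_ifs with hq
    · rw [← hCcard, hq]; simp [centralizerCard]
    · have : IsEmpty {t : G // t * (s * q) * t⁻¹ = s} := ⟨fun ⟨t, ht⟩ => hq (by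
        have h1 : (s * q) ^ orderOf s = 1 := by
          have h2 := congrArg (· ^ orderOf s) ht
          simp only [conj_pow, pow_orderOf_eq_one] at h2
          rwa [mul_inv_eq_one, mul_eq_left] at h2
        rw [(hcomm q q.2).mul_pow, pow_orderOf_eq_one, one_mul] at h1
        have h3 : orderOf q ∣ orderOf s :=
          orderOf_dvd_of_pow_eq_one (Subtype.ext h1)
        have h4 := Nat.eq_one_of_dvd_coprimes (hcop q) h3 dvd_rfl
        exact orderOf_eq_one_iff.1 h4)⟩
      exact Nat.card_of_isEmpty
  have hnum1 : ∀ q : Q, Nat.card {t : G // t * (s * q) * t⁻¹ = 1} = 0 := by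
    intro q
    have : IsEmpty {t : G // t * (s * q) * t⁻¹ = 1} := ⟨fun ⟨t, ht⟩ => hne (by
      rw [mul_inv_eq_one, mul_eq_left, mul_eq_one_iff_eq_inv] at ht
      have h3 : orderOf s = orderOf q := by rw [ht, orderOf_inv, Subgroup.orderOf_coe]
      have h4 := hcop q
      rw [← h3, Nat.coprime_self, orderOf_eq_one_iff] at h4
      exact h4)⟩
    exact Nat.card_of_isEmpty
  have hint : ∀ χ : Irr G,
      IsIntegral ℤ ((Nat.card Q : ℂ)⁻¹ * ∑ q : Q, χ.1 (s * q)⁻¹) := by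
    intro χ
    have : ∑ q : Q, χ.1 (s * q)⁻¹ = ∑ q : Q, χ.1 (s⁻¹ * q) := by
      rw [← Equiv.sum_comp (Equiv.inv Q)]
      refine Finset.sum_congr rfl fun q _ => congrArg χ.1 ?_
      have := (hcomm q q.2).inv_right
      simp only [Equiv.inv_apply, Subgroup.coe_inv]
      rw [this.eq, mul_inv_rev, inv_inv]
    rw [this]
    obtain ⟨_, n, ρ, -, rfl⟩ := χ
    exact integral_average_character ρ Q s⁻¹ fun q hq => (hcomm q hq).inv_left
  have hQc : (Nat.card Q : ℂ) ≠ 0 := by exact_mod_cast Nat.card_pos.ne'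
  have hsum : ∀ g : G, ∑ χ : Irr G, ((Nat.card Q : ℂ)⁻¹ * ∑ q : Q, χ.1 (s * q)⁻¹) * χ.1 g =
      (Nat.card Q : ℂ)⁻¹ * ∑ q : Q, (Nat.card {t : G // t * (s * q) * t⁻¹ = g} : ℂ) := by
    intro g
    simp only [mul_assoc (Nat.card Q : ℂ)⁻¹, ← Finset.mul_sum, Finset.sum_mul]
    rw [Finset.sum_comm]
    simp only [Irr.sum_inv_mul]
  have hindex : (Nat.card Q : ℂ)⁻¹ * (Nat.card C : ℂ) = ((S : Subgroup C).index : ℂ) := by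
    rw [← (S : Subgroup C).card_mul_index, hcard]
    rw [hcard] at hQc
    push_cast
    field_simp
  have hs1 := hsum s
  have hs2 := hsum 1
  simp only [hnum, hnum1] at hs1 hs2
  simp only [Nat.cast_ite, Nat.cast_zero, Finset.sum_ite_eq', Finset.mem_univ, if_true,
    Finset.sum_const_zero, mul_zero] at hs1 hs2
  rw [hindex] at hs1
  have key : ∑ χ : Irr G, (⟨_, hint χ⟩ : integralClosure ℤ ℂ) * (Irr.value χ s - Irr.value χ 1) =
      ((S : Subgroup C).index : integralClosure ℤ ℂ) := by
    apply Subtype.ext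
    push_cast
    rw [← sub_zero (((S : Subgroup C).index : ℕ) : ℂ), ← hs1, ← hs2, ← Finset.sum_sub_distrib]
    refine Finset.sum_congr rfl fun χ _ => ?_
    rw [← mul_sub]
    rfl
  have := congrArg φ key
  simp only [map_sum, map_mul, map_sub, h, sub_self, mul_zero, Finset.sum_const_zero,
    map_natCast] at this
  exact S.not_dvd_index ((CharP.cast_eq_zero_iff k p _).1 this.symm)

/-- The `p`-elements are the elements at which every irreducible character is congruent to its
degree. -/
theorem isPElement_iff_reduction (x : G) :
    IsPElement p x ↔ ∀ χ : Irr G, φ (Irr.value χ x) = φ (Irr.value χ 1) := by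
  constructor
  · rintro ⟨j, hj⟩ χ
    apply (iterateFrobenius k p j).injective
    rw [← Irr.reduction_pow, ← hj, pow_orderOf_eq_one, Irr.reduction_one_fixed]
  · intro h
    have hp : p.Prime := Fact.out
    obtain ⟨j, m, hm, hjm⟩ :=
      Nat.exists_eq_pow_mul_and_not_dvd (orderOf_pos x).ne' p hp.ne_one
    refine ⟨j, ?_⟩
    have h1 : orderOf (x ^ p ^ j) = m := by
      rw [orderOf_pow_of_dvd (pow_pos hp.pos j).ne' ⟨m, hjm⟩, hjm,
        Nat.mul_div_cancel_left _ (pow_pos hp.pos j)]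
    have h2 : x ^ p ^ j = 1 := by
      -- `x ^ p ^ j` has order `m`, prime to `p`, and Frobenius carries the congruences from `x` to
      -- it.
      refine eq_one_of_coprime_of_reduction_eq (p := p) φ ?_ fun χ => ?_
      · rw [h1]
        exact ((Nat.Prime.coprime_iff_not_dvd hp).2 hm).symm
      · rw [Irr.reduction_pow, h, Irr.reduction_one_fixed]
    rw [h2, orderOf_one] at h1
    rw [hjm, ← h1, mul_one]

theorem TableCorr.isPElement_iff {H : Type*} [Group H] [Finite H] (p : ℕ) [Fact p.Prime]
    (T : TableCorr G H) {x : G} {y : H} (h : T.rel x y) : IsPElement p x ↔ IsPElement p y := by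
  obtain ⟨P, hP, hchar⟩ := exists_reduction_algebraicIntegers p
  let _ : Field (integralClosure ℤ ℂ ⧸ P) := Ideal.Quotient.field P
  rw [isPElement_iff_reduction (Ideal.Quotient.mk P), isPElement_iff_reduction (Ideal.Quotient.mk P),
    ← T.rows.forall_congr_right]
  refine forall_congr' fun χ => ?_
  have h1 : Irr.value (T.rows χ) y = Irr.value χ x := Subtype.ext (T.entry χ h)
  have h2 : Irr.value (T.rows χ) 1 = Irr.value χ 1 := Subtype.ext (T.rows_apply_one χ)
  rw [h1, h2]

end pElement

/-! ### Sylow subgroups containing an element, and passage to quotients. -/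

section sylow

variable {G : Type*} [Group G] {p : ℕ}

/-- The number of elements of `G` that conjugate `x` into `P`. -/
noncomputable def conjIntoCount (P : Subgroup G) (x : G) : ℕ :=
  Nat.card {g : G // g⁻¹ * x * g ∈ P}

theorem conjIntoCount_of_card_eq_one (hG : Nat.card G = 1) (P : Subgroup G) (x : G) :
    conjIntoCount P x = 1 := by
  have := (Nat.card_eq_one_iff_unique.1 hG).1
  rw [← hG]
  exact Nat.card_congr (Equiv.subtypeUnivEquiv fun g => by
    rw [Subsingleton.elim (g⁻¹ * x * g) 1]
    exact P.one_mem)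

theorem isPElement_of_mem_isPGroup {P : Subgroup G} (hP : IsPGroup p P) [Fact p.Prime] {x : G}
    (hx : x ∈ P) : IsPElement p x := by
  obtain ⟨j, hj⟩ := IsPGroup.iff_orderOf.1 hP ⟨x, hx⟩
  exact ⟨j, by rw [← hj, Subgroup.orderOf_mk]⟩

theorem IsPElement.conj {x : G} (hx : IsPElement p x) (t : G) : IsPElement p (t * x * t⁻¹) := by
  obtain ⟨j, hj⟩ := hx
  refine ⟨j, ?_⟩
  rw [← hj]
  exact MulEquiv.orderOf_eq (MulAut.conj t) x

theorem IsPElement.map {H : Type*} [Group H] [Fact p.Prime] {x : G} (hx : IsPElement p x)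
    (f : G →* H) : IsPElement p (f x) := by
  obtain ⟨j, hj⟩ := hx
  obtain ⟨i, -, hi⟩ := (Nat.dvd_prime_pow Fact.out).1 (hj ▸ orderOf_map_dvd f x)
  exact ⟨i, hi⟩

theorem IsPElement.isPGroup_zpowers {x : G} (hx : IsPElement p x) :
    IsPGroup p (Subgroup.zpowers x) := by
  obtain ⟨j, hj⟩ := hx
  exact IsPGroup.of_card (by rw [Nat.card_zpowers, hj])

theorem eq_one_of_mem_isPGroup_of_coprime {P N : Subgroup G} (hP : IsPGroup p P) [Fact p.Prime]
    (hN : (Nat.card N).Coprime p) {a : G} (haP : a ∈ P) (haN : a ∈ N) : a = 1 := by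
  obtain ⟨j, hj⟩ := isPElement_of_mem_isPGroup hP haP
  have h1 : orderOf a ∣ Nat.card N := Subgroup.orderOf_dvd_natCard N haN
  exact orderOf_eq_one_iff.1 (Nat.eq_one_of_dvd_coprimes (hN.pow_right j) h1 hj.dvd)

theorem sylowCount_pos [Finite G] {x : G} (hx : IsPElement p x) : 0 < sylowCount p x := by
  obtain ⟨Q, hQ⟩ := hx.isPGroup_zpowers.exists_le_sylow
  have : Nonempty {Q : Sylow p G // x ∈ Q} := ⟨⟨Q, hQ (Subgroup.mem_zpowers x)⟩⟩
  exact Nat.card_pos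

theorem sylowCount_eq_zero [Fact p.Prime] {x : G} (hx : ¬ IsPElement p x) : sylowCount p x = 0 := by
  have : IsEmpty {Q : Sylow p G // x ∈ Q} :=
    ⟨fun Q => hx (isPElement_of_mem_isPGroup Q.1.2 Q.2)⟩
  exact Nat.card_of_isEmpty

theorem mem_smul_sylow_iff (P : Sylow p G) (g x : G) : x ∈ g • P ↔ g⁻¹ * x * g ∈ P := by
  rw [← SetLike.mem_coe, Sylow.coe_smul, Set.mem_smul_set_iff_inv_smul_mem]
  simp [MulAut.smul_def, ← map_inv]

/-- A normal `p`-subgroup lies in `P`, so the condition on `g` depends only on its coset modulo `N`.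
-/
theorem conjIntoCount_of_isPGroup (N : Subgroup G) [N.Normal] (hN : IsPGroup p N)
    (P : Sylow p G) (x : G) :
    conjIntoCount (P : Subgroup G) x =
      Nat.card N * conjIntoCount ((P : Subgroup G).map (QuotientGroup.mk' N)) (x : G ⧸ N) := by
  refine Eq.trans ?_ (QuotientGroup.card_preimage_mk N
    {g : G ⧸ N | g⁻¹ * x * g ∈ (P : Subgroup G).map (QuotientGroup.mk' N)})
  refine Nat.card_congr (Equiv.subtypeEquivRight fun g => ?_)
  have hle : N ≤ P := hN.le_sylow_of_normal P
  change g⁻¹ * x * g ∈ (P : Subgroup G) ↔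
    (QuotientGroup.mk' N) (g⁻¹ * x * g) ∈ (P : Subgroup G).map (QuotientGroup.mk' N)
  rw [← Subgroup.mem_comap, Subgroup.comap_map_eq, QuotientGroup.ker_mk', sup_eq_left.2 hle]

variable [Finite G] [Fact p.Prime]

theorem sylowCount_mul_card_normalizer (P : Sylow p G) (x : G) :
    sylowCount p x * Nat.card (Subgroup.normalizer (P : Set G)) =
      conjIntoCount (P : Subgroup G) x := by
  cases nonempty_fintype {Q : Sylow p G // x ∈ Q}
  let f : {g : G // g⁻¹ * x * g ∈ (P : Subgroup G)} → {Q : Sylow p G // x ∈ Q} :=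
    fun g => ⟨g.1 • P, (mem_smul_sylow_iff P g.1 x).2 g.2⟩
  have hfib : ∀ Q, Nat.card {g // f g = Q} = Nat.card (Subgroup.normalizer (P : Set G)) := by
    rintro ⟨Q, hQ⟩
    obtain ⟨t, rfl⟩ := MulAction.exists_smul_eq G P Q
    refine Nat.card_congr
      { toFun := fun g => ⟨t⁻¹ * g.1.1, ?_⟩
        invFun := fun n => ⟨⟨t * n.1, ?_⟩, ?_⟩
        left_inv := fun g => by ext; simp
        right_inv := fun n => by ext; simp }
    · have h : g.1.1 • P = t • P := congrArg Subtype.val g.2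
      exact Sylow.smul_eq_iff_mem_normalizer.1 (by rw [mul_smul, h, inv_smul_smul])
    · have h : n.1 • P = P := Sylow.smul_eq_iff_mem_normalizer.2 n.2
      refine (mem_smul_sylow_iff P _ x).1 ?_
      rwa [mul_smul, h]
    · have h : n.1 • P = P := Sylow.smul_eq_iff_mem_normalizer.2 n.2
      exact Subtype.ext (show (t * n.1) • P = t • P by rw [mul_smul, h])
  rw [conjIntoCount, ← Nat.card_congr (Equiv.sigmaFiberEquiv f), Nat.card_sigma]
  simp only [hfib, Finset.sum_const, Finset.card_univ, smul_eq_mul]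
  rw [sylowCount, Nat.card_eq_fintype_card]

/-- The number of elements conjugating `x` into `P`, in terms of the class of `x`. -/
theorem conjIntoCount_eq_mul (P : Subgroup G) (x : G) :
    conjIntoCount P x = Nat.card {u : G // u ∈ P ∧ IsConj x u} * centralizerCard x := by
  classical
  cases nonempty_fintype G
  let f : {g : G // g⁻¹ * x * g ∈ P} → {u : G // u ∈ P ∧ IsConj x u} :=
    fun g => ⟨g.1⁻¹ * x * g.1, g.2, isConj_iff.2 ⟨g.1⁻¹, by rw [inv_inv]⟩⟩
  have hfib : ∀ u, Nat.card {g // f g = u} = centralizerCard x := by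
    rintro ⟨u, hu, hc⟩
    obtain ⟨t, rfl⟩ := isConj_iff.1 hc
    refine Nat.card_congr
      { toFun := fun g => ⟨g.1.1 * t, ?_⟩
        invFun := fun c => ⟨⟨c.1 * t⁻¹, ?_⟩, ?_⟩
        left_inv := fun g => by ext; simp
        right_inv := fun c => by ext; simp }
    · have h : g.1.1⁻¹ * x * g.1.1 = t * x * t⁻¹ := congrArg Subtype.val g.2
      calc g.1.1 * t * x * (g.1.1 * t)⁻¹ = g.1.1 * (t * x * t⁻¹) * g.1.1⁻¹ := by group
        _ = g.1.1 * (g.1.1⁻¹ * x * g.1.1) * g.1.1⁻¹ := by rw [h]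
        _ = x := by group
    all_goals
      have h : (c.1 * t⁻¹)⁻¹ * x * (c.1 * t⁻¹) = t * x * t⁻¹ := by
        have h3 : c.1⁻¹ * x * c.1 = x := by
          have h4 := c.2
          rw [mul_inv_eq_iff_eq_mul] at h4
          rw [mul_assoc, ← h4, inv_mul_cancel_left]
        calc _ = t * (c.1⁻¹ * x * c.1) * t⁻¹ := by group
          _ = _ := by rw [h3]
    · rw [h]; exact hu
    · exact Subtype.ext h
  rw [conjIntoCount, ← Nat.card_congr (Equiv.sigmaFiberEquiv f), Nat.card_sigma]
  simp only [hfib, Finset.sum_const, Finset.card_univ, smul_eq_mul]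
  rw [Nat.card_eq_fintype_card]

/-- Two `p`-elements in the same coset of a normal subgroup of order prime to `p` are conjugate. -/
theorem isConj_of_mk_eq_of_coprime (N : Subgroup G) [N.Normal] (hN : (Nat.card N).Coprime p)
    {z u : G} (hz : IsPElement p z) (hu : IsPElement p u) (h : (z : G ⧸ N) = u) : IsConj z u := by
  -- Conjugating by elements of `K` keeps `z` in the coset `u * N`; Sylow's theorem in `K` moves `z`
  -- into a Sylow subgroup containing `u`. That subgroup meets `N` trivially, so the conjugate is
  -- `u`.
  let K : Subgroup G := (Subgroup.centralizer {(u : G ⧸ N)}).comap (QuotientGroup.mk' N)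
  have hK : ∀ k ∈ K, (k : G ⧸ N) * u = u * k := fun k hk =>
    Subgroup.mem_centralizer_singleton_iff.1 hk
  have huK : u ∈ K := Subgroup.mem_centralizer_singleton_iff.2 rfl
  have hzK : z ∈ K := Subgroup.mem_centralizer_singleton_iff.2 (by
    change (z : G ⧸ N) * u = u * z
    rw [h])
  have hpK : ∀ a : K, IsPElement p a.1 → IsPElement p a := fun a ⟨j, hj⟩ =>
    ⟨j, by rw [← hj, Subgroup.orderOf_coe]⟩
  obtain ⟨S, hS⟩ := (hpK ⟨u, huK⟩ hu).isPGroup_zpowers.exists_le_sylow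
  obtain ⟨R, hR⟩ := (hpK ⟨z, hzK⟩ hz).isPGroup_zpowers.exists_le_sylow
  obtain ⟨k, rfl⟩ := MulAction.exists_smul_eq K S R
  have hw := (mem_smul_sylow_iff S k _).1 (hR (Subgroup.mem_zpowers _))
  have hu' := hS (Subgroup.mem_zpowers _)
  have hmem := S.mul_mem hw (S.inv_mem hu')
  have hone := eq_one_of_mem_isPGroup_of_coprime (N := N) (S.2.map K.subtype) hN
    (Subgroup.mem_map_of_mem K.subtype hmem) (by
      rw [← QuotientGroup.eq_one_iff]
      change (((k.1⁻¹ * z * k.1) * u⁻¹ : G) : G ⧸ N) = 1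
      have hk := hK k.1 k.2
      simp only [QuotientGroup.mk_mul, QuotientGroup.mk_inv]
      rw [h, mul_assoc _ (u : G ⧸ N), ← hk]
      simp)
  change (k.1⁻¹ * z * k.1) * u⁻¹ = 1 at hone
  exact isConj_iff.2 ⟨k.1⁻¹, by rw [inv_inv]; exact mul_inv_eq_one.1 hone⟩

/-- Reduction modulo `N` is injective on `P` because `P ∩ N = 1`, and onto the target because
`p`-elements with equal image are conjugate. -/
theorem card_conj_mem_of_coprime (N : Subgroup G) [N.Normal] (hN : (Nat.card N).Coprime p)
    {P : Subgroup G} (hP : IsPGroup p P) {x : G} (hx : IsPElement p x) :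
    Nat.card {u : G // u ∈ P ∧ IsConj x u} =
      Nat.card {v : G ⧸ N // v ∈ P.map (QuotientGroup.mk' N) ∧ IsConj (x : G ⧸ N) v} := by
  refine Nat.card_congr (Equiv.ofBijective
    (fun u => ⟨(u.1 : G ⧸ N), Subgroup.mem_map_of_mem _ u.2.1,
      (QuotientGroup.mk' N).map_isConj u.2.2⟩) ⟨?_, ?_⟩)
  · rintro ⟨u, hu, _⟩ ⟨v, hv, _⟩ h
    have h1 : u⁻¹ * v ∈ N := QuotientGroup.eq.1 (congrArg Subtype.val h)
    exact Subtype.ext (inv_mul_eq_one.1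
      (eq_one_of_mem_isPGroup_of_coprime hP hN (P.mul_mem (P.inv_mem hu) hv) h1))
  · rintro ⟨_, ⟨u, hu, rfl⟩, hc⟩
    obtain ⟨t, ht⟩ := isConj_iff.1 hc
    obtain ⟨t, rfl⟩ := QuotientGroup.mk_surjective t
    have h1 : IsConj (t * x * t⁻¹) u :=
      isConj_of_mk_eq_of_coprime N hN (hx.conj t) (isPElement_of_mem_isPGroup hP hu) ht
    exact ⟨⟨u, hu, (isConj_iff.2 ⟨t, rfl⟩ : IsConj x (t * x * t⁻¹)).trans h1⟩, rfl⟩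

theorem conjIntoCount_of_coprime (N : Subgroup G) [N.Normal] (hN : (Nat.card N).Coprime p)
    {P : Subgroup G} (hP : IsPGroup p P) {x : G} (hx : IsPElement p x) :
    conjIntoCount P x * centralizerCard (x : G ⧸ N) =
      conjIntoCount (P.map (QuotientGroup.mk' N)) (x : G ⧸ N) * centralizerCard x := by
  rw [conjIntoCount_eq_mul, conjIntoCount_eq_mul, card_conj_mem_of_coprime N hN hP hx]
  ring

end sylow

/-! ### Induction along the `p`-series and the equivalences. -/

section main

variable {p : ℕ}

theorem relIndex_map_dvd {G G' : Type*} [Group G] [Group G'] (f : G →* G') {A B : Subgroup G}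
    [A.Normal] (hAB : A ≤ B) : (A.map f).relIndex (B.map f) ∣ A.relIndex B := by
  have h : B ⊔ f.ker = B ⊔ (A ⊔ f.ker) := by rw [← sup_assoc, sup_eq_left.2 hAB]
  rw [Subgroup.relIndex_map_map, h, Subgroup.relIndex_sup_right]
  exact Subgroup.relIndex_dvd_of_le_left B le_sup_left

/-- `G` has a series of `n` normal steps, each of index a power of `p` or prime to `p`. -/
def HasPSeries (p n : ℕ) (G : Type*) [Group G] : Prop :=
  ∃ N : ℕ → Subgroup G,
    N 0 = ⊥ ∧ N n = ⊤ ∧ (∀ i, (N i).Normal) ∧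
    ∀ i < n, N i ≤ N (i + 1) ∧
      ((∃ k : ℕ, (N i).relIndex (N (i + 1)) = p ^ k) ∨
        ((N i).relIndex (N (i + 1))).Coprime p)

theorem HasPSeries.exists_quotient [Fact p.Prime] {n : ℕ} {G : Type*} [Group G]
    (h : HasPSeries p (n + 1) G) :
    ∃ N : Subgroup G, ∃ _ : N.Normal, ((∃ k : ℕ, Nat.card N = p ^ k) ∨ (Nat.card N).Coprime p) ∧
      HasPSeries p n (G ⧸ N) := by
  obtain ⟨N, h0, hn, hnorm, hstep⟩ := h
  have := hnorm
  refine ⟨N 1, hnorm 1, ?_, fun i => (N (i + 1)).map (QuotientGroup.mk' (N 1)), ?_, ?_, ?_, ?_⟩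
  · have h1 := (hstep 0 n.succ_pos).2
    rwa [h0, zero_add, Subgroup.relIndex_bot_left] at h1
  · change (N 1).map _ = ⊥
    rw [Subgroup.map_eq_bot_iff, QuotientGroup.ker_mk']
  · change (N (n + 1)).map _ = ⊤
    rw [hn, ← MonoidHom.range_eq_map, QuotientGroup.range_mk']
  · exact fun i => (hnorm (i + 1)).map _ (QuotientGroup.mk'_surjective _)
  · intro i hi
    obtain ⟨hle, h2⟩ := hstep (i + 1) (Nat.succ_lt_succ hi)
    have hdvd := relIndex_map_dvd (QuotientGroup.mk' (N 1)) hle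
    refine ⟨Subgroup.map_mono hle, h2.imp ?_ fun h => h.coprime_dvd_left hdvd⟩
    rintro ⟨k, hk⟩
    obtain ⟨j, -, hj⟩ := (Nat.dvd_prime_pow Fact.out).1 (hk ▸ hdvd)
    exact ⟨j, hj⟩

/-- In a `p`-solvable group, the number of elements conjugating a given `p`-element into a Sylow
`p`-subgroup can be read off from the character table. -/
theorem TableCorr.conjIntoCount_eq [Fact p.Prime] (n : ℕ) :
    ∀ {G H : Type*} [Group G] [Group H] [Finite G] [Finite H], HasPSeries p n G →
      ∀ (T : TableCorr G H) (P : Sylow p G) (Q : Sylow p H) {x : G} {y : H},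
        T.rel x y → IsPElement p x →
          conjIntoCount (P : Subgroup G) x = conjIntoCount (Q : Subgroup H) y := by
  induction n with
  | zero =>
    rintro G H _ _ _ _ ⟨N, h0, hn, -, -⟩ T P Q x y hxy _
    have hG : Nat.card G = 1 := by
      rw [← Subgroup.card_top, ← hn, h0, Subgroup.card_bot]
    have hH : Nat.card H = 1 := T.card_eq ▸ hG
    rw [conjIntoCount_of_card_eq_one hG, conjIntoCount_of_card_eq_one hH]
  | succ n ih =>
    intro G H _ _ _ _ hG T P Q x y hxy hx
    obtain ⟨N, hN, hcard, hquot⟩ := hG.exists_quotient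
    let M := T.mapNormal N
    have hM : Nat.card M = Nat.card N := T.card_mapNormal N
    have hy : IsPElement p y := (T.isPElement_iff p hxy).1 hx
    have key := ih hquot (T.quotient N) (P.mapSurjective (QuotientGroup.mk'_surjective N))
      (Q.mapSurjective (QuotientGroup.mk'_surjective M)) (T.quotient_rel N hxy)
      (hx.map (QuotientGroup.mk' N))
    rw [Sylow.coe_mapSurjective, Sylow.coe_mapSurjective] at key
    -- `M` has the order of `N`, so the same case applies on both sides.
    rcases hcard with ⟨k, hk⟩ | hcop
    · rw [conjIntoCount_of_isPGroup N (IsPGroup.of_card hk) P,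
        conjIntoCount_of_isPGroup M (IsPGroup.of_card (hM.trans hk)) Q, hM, key]
    · have h1 := conjIntoCount_of_coprime N hcop P.2 hx
      have h2 := conjIntoCount_of_coprime M (hM ▸ hcop) Q.2 hy
      rw [← (T.quotient N).centralizerCard_eq (T.quotient_rel N hxy),
        ← T.centralizerCard_eq hxy, ← key, ← h1] at h2
      have hpos : 0 < centralizerCard (x : G ⧸ N) := by
        have : Nonempty {t : G ⧸ N // t * x * t⁻¹ = x} := ⟨⟨1, by simp⟩⟩
        exact Nat.card_pos
      exact (Nat.eq_of_mul_eq_mul_right hpos h2).symm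

theorem CharacterTableIso.sylowCount_mul_card_normalizer_eq [Fact p.Prime] {G H : Type*} [Group G]
    [Group H] [Finite G] [Finite H] (hG : IsPSolvable p G) (T : CharacterTableIso G H)
    (P : Sylow p G) (Q : Sylow p H) {x : G} {y : H}
    (h : T.cols (ConjClasses.mk x) = ConjClasses.mk y) (hx : IsPElement p x) :
    sylowCount p x * Nat.card (Subgroup.normalizer (P : Set G)) =
      sylowCount p y * Nat.card (Subgroup.normalizer (Q : Set H)) := by
  obtain ⟨n, hn⟩ := hG
  rw [sylowCount_mul_card_normalizer, sylowCount_mul_card_normalizer]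
  exact TableCorr.conjIntoCount_eq n hn T.toCorr P Q h hx

theorem isPElement_one {G : Type*} [Group G] : IsPElement p (1 : G) := ⟨0, by simp⟩

theorem tableDeterminesSylowCount_of_normalizer {G : Type*} [Group G] [Finite G] [Fact p.Prime]
    (hG : IsPSolvable p G) (P : Sylow p G) (h : TableDeterminesNormalizer p P) :
    TableDeterminesSylowCount p G := by
  intro x H _ _ T y hxy
  by_cases hx : IsPElement p x
  · have h1 := T.sylowCount_mul_card_normalizer_eq hG P default hxy hx
    rw [h H ⟨T⟩ default] at h1
    exact (Nat.eq_of_mul_eq_mul_right Nat.card_pos h1).symm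
  · have hy : ¬ IsPElement p y := fun hy =>
      hx ((T.toCorr.isPElement_iff p (x := x) (y := y) hxy).2 hy)
    rw [sylowCount_eq_zero hx, sylowCount_eq_zero hy]

theorem tableDeterminesNormalizer_of_sylowCountAt {G : Type*} [Group G] [Finite G] [Fact p.Prime]
    (hG : IsPSolvable p G) (P : Sylow p G) {x : G} (hx : IsPElement p x)
    (h : TableDeterminesSylowCountAt p x) : TableDeterminesNormalizer p P := by
  rintro H _ _ ⟨T⟩ Q
  obtain ⟨y, hy⟩ := ConjClasses.mk_surjective (T.cols (ConjClasses.mk x))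
  have h1 := T.sylowCount_mul_card_normalizer_eq hG P Q hy.symm hx
  rw [h H T y hy.symm] at h1
  exact (Nat.eq_of_mul_eq_mul_left (sylowCount_pos hx) h1).symm

end main

theorem mainTheorem8 {G : Type*} [Group G] [Finite G] (p : ℕ) [Fact p.Prime]
    (hG : IsPSolvable p G) (P : Sylow p G) :
    (TableDeterminesNormalizer p P ↔ TableDeterminesSylowCount p G) ∧
    (p ∣ Nat.card G →
      List.TFAE [
        TableDeterminesNormalizer p P,
        TableDeterminesSylowCount p G,
        ∃ x : G, IsPElement p x ∧ x ≠ 1 ∧ TableDeterminesSylowCountAt p x]) := by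
  have h12 : TableDeterminesNormalizer p P ↔ TableDeterminesSylowCount p G :=
    ⟨tableDeterminesSylowCount_of_normalizer hG P, fun h =>
      -- The identity serves as the `p`-element here, so `p ∣ |G|` is not needed.
      tableDeterminesNormalizer_of_sylowCountAt hG P isPElement_one (h 1)⟩
  refine ⟨h12, fun hp => ?_⟩
  tfae_have 1 ↔ 2 := h12
  tfae_have 2 → 3 := fun h => by
    -- Cauchy's theorem supplies the nonidentity `p`-element.
    obtain ⟨x, hx⟩ := exists_prime_orderOf_dvd_card' p hp
    refine ⟨x, ⟨1, by rw [hx, pow_one]⟩, ?_, h x⟩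
    rintro rfl
    rw [orderOf_one] at hx
    exact (Fact.out : p.Prime).one_lt.ne hx
  tfae_have 3 → 1 := fun ⟨x, hx, _, h⟩ =>
    tableDeterminesNormalizer_of_sylowCountAt hG P hx h
  tfae_finish
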